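/- Choose $n$ points independently and uniformly at random from the unit square $[0,1]^2$ and, independently of their positions, join each pair of them independently with probability $p\in[0,1]$; call the resulting graph $G$. Give each edge $uv$ a weight equal to the Euclidean distance $d(u,v)$, let $d_G(u,v)$ be the shortest-path distance in the weighted graph ($\infty$ if there is no path), and let $\mathcal F(n,p)=\max_{u\ne v} d_G(u,v)/d(u,v)$ be the stretch factor of $G$; if $G$ is disconnected, the stretch factor is undefined (treated as $\infty$), so the event $\mathcal F(n,p)<\lambda$ does not occur. (1) There is a sequence $\varepsilon_n\to 0$ such that for every real $c$ with $\frac1{51}<c<\frac1{16\pi}$, every $n$, every $p\in[0,1]$ and every $\lambda>0$, $$\mathbf{Pr}\left[\mathcal F(n,p)<\lambda\right]\le \exp\left[-\frac{c\,n(1-p)}{2e^{8}\lambda^{2}}\right]+\varepsilon_n .$$ In particular, the $o(1)$ term is uniform in $p$ and $\lambda$, which may depend on $n$. (2) Consequently, let $p=p(n)\in[0,1]$ satisfy $n(1-p)=\Theta(1)$. Then for every fixed $\lambda>0$ the event "$G$ is connected and $\mathcal F(n,p)>\lambda$" has probability $\Omega(1)$ as $n\to\infty$. Thus $\mathcal F(n,p)$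 is not concentrated, in the sense that there is no constant $\lambda$ for which $\mathcal F(n,p)<\lambda$ asymptotically almost surely. This answers, in this regime, O'Rourke's question for which $p$ the stretch factor is bounded asymptotically almost surely. -/

import Mathlib

open MeasureTheory ProbabilityTheory Filter Topology Asymptotics
open scoped ENNReal

noncomputable section

namespace RandomStretch

/-- The Euclidean plane. -/
abbrev Plane : Type := EuclideanSpace ℝ (Fin 2)

/-- The unit square `[0,1]²`. -/
def unitSquare : Set Plane := {z | ∀ i, z i ∈ Set.Icc (0 : ℝ) 1}

/-- The unit square has area one, so that Lebesgue measure restricted to it is the uniform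
distribution on it. -/
theorem volume_unitSquare : volume unitSquare = 1 := by
  have h := (EuclideanSpace.volume_preserving_symm_measurableEquiv_toLp
    (Fin 2)).symm.measure_preimage_equiv unitSquare
  rw [← h]
  have h2 : (MeasurableEquiv.toLp 2 (Fin 2 → ℝ)).symm.symm ⁻¹' unitSquare
      = Set.pi Set.univ fun _ : Fin 2 => Set.Icc (0 : ℝ) 1 := by
    ext f
    simp only [unitSquare, Set.mem_preimage, Set.mem_ofPred_eq, Set.mem_pi, Set.mem_univ,
      true_imp_iff]
    rfl
  rw [h2, volume_pi_pi]
  simp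

/-- The uniform distribution on the unit square. -/
def uniformSquare : Measure Plane := volume.restrict unitSquare

instance : IsProbabilityMeasure uniformSquare :=
  ⟨by simp [uniformSquare, volume_unitSquare]⟩

variable {V : Type*}

/-- The weight of a walk in a graph whose vertices are placed at the points `x v` of the plane:
the sum of the Euclidean lengths of its edges. -/
def walkWeight (x : V → Plane) {G : SimpleGraph V} {u v : V} (w : G.Walk u v) : ℝ≥0∞ :=
  (w.darts.map fun e => edist (x e.fst) (x e.snd)).sum

/-- The shortest-path distance `d_G(u, v)` in the weighted graph; it is `∞` if there is no walk
from `u` to `v`. -/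
def graphDist (x : V → Plane) (G : SimpleGraph V) (u v : V) : ℝ≥0∞ :=
  ⨅ w : G.Walk u v, walkWeight x w

/-- The stretch factor of the embedded graph: the maximum of `d_G(u, v) / d(u, v)` over all pairs
of distinct vertices. For a disconnected graph the value is `∞`, which stands for "undefined". -/
def stretchFactor (x : V → Plane) (G : SimpleGraph V) : ℝ≥0∞ :=
  ⨆ (u : V) (v : V) (_ : u ≠ v), graphDist x G u v / edist (x u) (x v)

/-- The law of the randomly embedded random graph: `n` points chosen independently and uniformly
from the unit square and, independently of them, a binomial random graph `G(n, p)` on the `n`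
points. -/
def embeddedGraphLaw (n : ℕ) (p : unitInterval) :
    Measure ((Fin n → Plane) × SimpleGraph (Fin n)) :=
  (Measure.pi fun _ : Fin n => uniformSquare).prod (SimpleGraph.binomialRandom (Fin n) p)

end RandomStretch

end

namespace RandomStretch

/-! ### Edges of the binomial random graph -/

/-! Two nonadjacent points that are much closer to each other than to every other point force a
large stretch factor, since any path between them starts with a long edge. There are linearly many
candidate pairs. Take `t = ⌈2λ⌉` and cut the square into `k²` cells with `2n ≤ k² ≤ 8n`, and each
cell into `(4t)²` subcells. Call a cell good if it contains exactly two points, both in the same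
subcell of its middle part. If `stretchFactor < λ`, each good cell must contain an edge
(`adj_of_stretchFactor_lt`). These edges are distinct, so given the positions this has probability
at most `p ^ #good`. The average of `p ^ #good` is a finite sum over cells and subcells of the
points. For fixed cells, the sum over subcells factorizes (`sum_pow_card_goodBoxes`) and decays
exponentially in the number of two-point cells. That number is at least `n / 128` outside
probability `O(1/n)`, by a mean computation and Chebyshev (`card_few_twoBallBoxes_le`). When `n(1-p)
= Θ(1)`, the resulting bound stays below `1`, while disconnection has probability `O(1/n)`. -/

theorem measurableSet_mem_edgeSet {V : Type*} (e : Sym2 V) :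
    MeasurableSet {G : SimpleGraph V | e ∈ G.edgeSet} :=
  SimpleGraph.measurable_edgeSet (measurableSet_setOfPred.2 (measurable_set_mem e))

/-- The random graph is the image of independent coordinates indexed by `Sym2 V`, so the event is a
cylinder and its measure a finite product. Diagonal coordinates are almost surely `False`, hence
their exclusion. -/
theorem binomialRandom_real_edges {V : Type*} [Countable V] (p : unitInterval)
    (A B : Finset (Sym2 V)) (hAB : Disjoint A B)
    (hA : ∀ e ∈ A, ¬ e.IsDiag) (hB : ∀ e ∈ B, ¬ e.IsDiag) :
    (SimpleGraph.binomialRandom V p).real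
      {G | (∀ e ∈ A, e ∈ G.edgeSet) ∧ ∀ e ∈ B, e ∉ G.edgeSet}
      = (p : ℝ) ^ A.card * (1 - (p : ℝ)) ^ B.card := by
  classical
  have hmeas : MeasurableSet {G : SimpleGraph V | (∀ e ∈ A, e ∈ G.edgeSet) ∧
      ∀ e ∈ B, e ∉ G.edgeSet} := by
    have : {G : SimpleGraph V | (∀ e ∈ A, e ∈ G.edgeSet) ∧ ∀ e ∈ B, e ∉ G.edgeSet}
        = (⋂ e ∈ A, {G | e ∈ G.edgeSet}) ∩ ⋂ e ∈ B, {G | e ∈ G.edgeSet}ᶜ := by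
      ext G; simp
    rw [this]
    exact (A.measurableSet_biInter fun e _ => measurableSet_mem_edgeSet e).inter
      (B.measurableSet_biInter fun e _ => (measurableSet_mem_edgeSet e).compl)
  rw [measureReal_def, SimpleGraph.binomialRandom_eq_map,
    Measure.map_apply SimpleGraph.measurable_fromEdgeSet hmeas, setBernoulli_apply']
  have hset : (fun P : Sym2 V → Prop => {i | P i}) ⁻¹' (SimpleGraph.fromEdgeSet ⁻¹'
      {G : SimpleGraph V | (∀ e ∈ A, e ∈ G.edgeSet) ∧ ∀ e ∈ B, e ∉ G.edgeSet})
      = Set.pi (A ∪ B : Finset (Sym2 V)) (fun e => if e ∈ A then {True} else {False}) := by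
    ext P
    simp only [Set.mem_preimage, Set.mem_ofPred_eq, SimpleGraph.edgeSet_fromEdgeSet, Set.mem_pi,
      Finset.mem_coe, Finset.mem_union, Set.mem_sdiff]
    constructor
    · rintro ⟨h1, h2⟩ e he
      by_cases heA : e ∈ A
      · simpa [heA] using (h1 e heA).1
      · have heB : e ∈ B := he.resolve_left heA
        have := h2 e heB
        simp only [heA, if_false, Set.mem_singleton_iff, eq_iff_iff, iff_false]
        exact fun hP => this ⟨hP, hB e heB⟩
    · refine fun h => ⟨fun e he => ⟨?_, hA e he⟩, fun e he => ?_⟩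
      · simpa [he] using h e (Or.inl he)
      · have heA : e ∉ A := fun hh => Finset.disjoint_left.1 hAB hh he
        have := h e (Or.inr he)
        simp only [heA, if_false, Set.mem_singleton_iff, eq_iff_iff, iff_false] at this
        exact fun hP => this hP.1
  rw [hset, Measure.infinitePi_pi _ (fun e _ => by split_ifs <;> measurability),
    Finset.prod_union hAB]
  have h1 : ∀ e ∈ A, ((unitInterval.toNNReal p • Measure.dirac (e ∈ (Sym2.diagSet : Set (Sym2 V))ᶜ)
      + unitInterval.toNNReal (unitInterval.symm p) • Measure.dirac False : Measure Prop))
      (if e ∈ A then {True} else {False}) = (unitInterval.toNNReal p : ℝ≥0∞) := by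
    intro e he
    have hed : (e ∈ (Sym2.diagSet : Set (Sym2 V))ᶜ) = True := by simpa using hA e he
    rw [hed, if_pos he]
    simp
  have h2 : ∀ e ∈ B, ((unitInterval.toNNReal p • Measure.dirac (e ∈ (Sym2.diagSet : Set (Sym2 V))ᶜ)
      + unitInterval.toNNReal (unitInterval.symm p) • Measure.dirac False : Measure Prop))
      (if e ∈ A then {True} else {False}) = (unitInterval.toNNReal (unitInterval.symm p) : ℝ≥0∞) := by
    intro e he
    have heA : e ∉ A := fun hh => Finset.disjoint_left.1 hAB hh he
    have hed : (e ∈ (Sym2.diagSet : Set (Sym2 V))ᶜ) = True := by simpa using hB e he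
    rw [hed, if_neg heA]
    simp
  rw [Finset.prod_congr rfl h1, Finset.prod_congr rfl h2]
  simp

theorem binomialRandom_real_adj {V : Type*} [Countable V] {ι : Type*}
    (p : unitInterval) (J : Finset ι) (u v : ι → V) (huv : ∀ j ∈ J, u j ≠ v j)
    (hinj : ∀ i ∈ J, ∀ j ∈ J, s(u i, v i) = s(u j, v j) → i = j) :
    (SimpleGraph.binomialRandom V p).real {G | ∀ j ∈ J, G.Adj (u j) (v j)} = (p : ℝ) ^ J.card := by
  classical
  have h := binomialRandom_real_edges p (J.image fun j => s(u j, v j)) ∅ (by simp)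
    (by simpa using huv) (by simp)
  rw [Finset.card_image_of_injOn (fun i hi j hj => hinj i hi j hj)] at h
  simpa using h

/-- A binomial random graph is disconnected with probability at most `(1 - p) + n (1 - p)²`. -/
theorem binomialRandom_real_not_connected_le {n : ℕ} (hn : 2 ≤ n) (p : unitInterval) :
    (SimpleGraph.binomialRandom (Fin n) p).real {G | ¬ G.Connected}
      ≤ (1 - (p : ℝ)) + n * (1 - (p : ℝ)) ^ 2 := by
  classical
  let a : Fin n := ⟨0, by omega⟩
  let b : Fin n := ⟨1, by omega⟩
  have hab : a ≠ b := by simp [a, b]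
  -- An edge `ab`, with every other vertex adjacent to `a` or `b`, already connects the graph.
  have hsub : {G : SimpleGraph (Fin n) | ¬ G.Connected} ⊆ {G | ¬ G.Adj a b} ∪
      ⋃ v ∈ (Finset.univ : Finset (Fin n)), {G | v ≠ a ∧ v ≠ b ∧ ¬ G.Adj v a ∧ ¬ G.Adj v b} := by
    intro G hG
    by_contra hcon
    simp only [Set.mem_union, Set.mem_ofPred_eq, Set.mem_iUnion, Finset.mem_univ, exists_prop,
      true_and, not_or, not_not, not_exists, not_and] at hcon
    obtain ⟨h1, h2⟩ := hcon
    have hr : ∀ v, G.Reachable v a := by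
      intro v
      by_cases hva : v = a
      · exact hva ▸ .refl _
      by_cases hvb : v = b
      · exact hvb ▸ h1.symm.reachable
      by_cases hadj : G.Adj v a
      · exact hadj.reachable
      · exact (h2 v hva hvb hadj).reachable.trans h1.symm.reachable
    exact hG ((SimpleGraph.connected_iff _).2
      ⟨fun v w => (hr v).trans (hr w).symm, ⟨a⟩⟩)
  have e1 : (SimpleGraph.binomialRandom (Fin n) p).real {G | ¬ G.Adj a b} = 1 - (p : ℝ) := by
    have := binomialRandom_real_edges p ∅ {s(a, b)} (by simp) (by simp) (by simpa using hab)
    simpa using this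
  have e2 : ∀ v : Fin n, (SimpleGraph.binomialRandom (Fin n) p).real
      {G | v ≠ a ∧ v ≠ b ∧ ¬ G.Adj v a ∧ ¬ G.Adj v b} ≤ (1 - (p : ℝ)) ^ 2 := by
    intro v
    by_cases hv : v ≠ a ∧ v ≠ b
    · have := binomialRandom_real_edges p ∅ {s(v, a), s(v, b)} (by simp) (by simp)
        (by simpa using hv)
      rw [Finset.card_pair (by simpa [hab] using fun h => absurd h hv.2)] at this
      refine le_of_eq ?_
      simpa [hv] using this
    · have : {G : SimpleGraph (Fin n) | v ≠ a ∧ v ≠ b ∧ ¬ G.Adj v a ∧ ¬ G.Adj v b} = ∅ := by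
        ext G
        simp only [Set.mem_ofPred_eq, Set.mem_empty_iff_false, iff_false]
        tauto
      rw [this]
      simpa using sq_nonneg _
  calc _ ≤ _ := measureReal_mono hsub
    _ ≤ _ := measureReal_union_le _ _
    _ ≤ (1 - (p : ℝ)) + ∑ v : Fin n, (1 - (p : ℝ)) ^ 2 := by
      rw [e1]
      gcongr
      exact (measureReal_biUnion_finset_le _ _).trans (Finset.sum_le_sum fun v _ => e2 v)
    _ = _ := by simp

/-! ### Lower bounds for the stretch factor -/

section Geometry
variable {V : Type*} (x : V → Plane) (G : SimpleGraph V)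

theorem edist_le_graphDist (u v : V) : edist (x u) (x v) ≤ graphDist x G u v := by
  refine le_iInf fun w => ?_
  induction w with
  | nil => simp
  | cons h w ih =>
    simp only [walkWeight, SimpleGraph.Walk.darts_cons, List.map_cons, List.sum_cons]
    exact (edist_triangle _ _ _).trans (add_le_add_right ih _)

theorem one_le_stretchFactor {u v : V} (huv : x u ≠ x v) : 1 ≤ stretchFactor x G := by
  refine le_trans ?_ (le_iSup_of_le u (le_iSup_of_le v (le_iSup_of_le (ne_of_apply_ne x huv) le_rfl)))
  rw [ENNReal.le_div_iff_mul_le (Or.inl (by simpa using huv)) (Or.inl (edist_ne_top _ _)), one_mul]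
  exact edist_le_graphDist x G u v

/-- A nonadjacent pair of points that are close to each other compared to the distance to all
other points forces a large stretch factor. -/
theorem le_stretchFactor_of_not_adj {u v : V} (huv : u ≠ v) (hadj : ¬ G.Adj u v) {lam r : ℝ}
    (hr : 0 < r) (hlam : 0 ≤ lam) (hclose : lam * dist (x u) (x v) ≤ r)
    (hfar : ∀ w, w ≠ u → w ≠ v → r ≤ dist (x u) (x w)) :
    ENNReal.ofReal lam ≤ stretchFactor x G := by
  refine le_trans ?_ (le_iSup_of_le u (le_iSup_of_le v (le_iSup_of_le huv le_rfl)))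
  -- The first edge of a walk from `u` cannot end at `v`, so it alone has length at least `r`.
  have hd : ENNReal.ofReal r ≤ graphDist x G u v := by
    refine le_iInf fun w => ?_
    cases w with
    | nil => exact absurd rfl huv
    | @cons _ z _ h w =>
      simp only [walkWeight, SimpleGraph.Walk.darts_cons, List.map_cons, List.sum_cons]
      refine le_trans ?_ le_self_add
      rw [edist_dist]
      refine ENNReal.ofReal_le_ofReal (hfar z h.ne' ?_)
      rintro rfl
      exact hadj h
  -- The two points may coincide; a nonzero numerator keeps the division lemma applicable.
  have hpos : graphDist x G u v ≠ 0 := (lt_of_lt_of_le (by simpa using hr) hd).ne'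
  rw [ENNReal.le_div_iff_mul_le (Or.inr hpos) (Or.inl (edist_ne_top _ _)), edist_dist,
    ← ENNReal.ofReal_mul hlam]
  exact (ENNReal.ofReal_le_ofReal hclose).trans hd

end Geometry

/-! ### Discretization of the square -/

/-- The index, among `m` intervals of length `1 / m`, of the interval containing `a`; numbers
outside of `[0, 1]` are assigned to the first or the last interval. -/
noncomputable def gridIndex (m : ℕ) (a : ℝ) : ℕ := min ⌊a * m⌋₊ (m - 1)

theorem gridIndex_lt {m : ℕ} (hm : 0 < m) (a : ℝ) : gridIndex m a < m := by
  unfold gridIndex; omega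

/-- The index is clamped at both ends: it bounds `a` from below only if positive, and from above
only if less than `m - 1`. The side conditions here and in the next two lemmas exclude the end
intervals. -/
theorem le_of_le_gridIndex {m i : ℕ} {a : ℝ} (hi : 0 < i) (h : i ≤ gridIndex m a) :
    (i : ℝ) ≤ a * m := by
  have : i ≤ ⌊a * m⌋₊ := h.trans (min_le_left _ _)
  exact (Nat.le_floor_iff' hi.ne').1 this

theorem lt_of_gridIndex_lt {m i : ℕ} {a : ℝ} (hi : i < m) (h : gridIndex m a < i) :
    a * m < i := by
  have : ⌊a * m⌋₊ < i := by unfold gridIndex at h; omega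
  exact (Nat.floor_lt' (by omega)).1 this

theorem abs_sub_lt_of_gridIndex_eq {m : ℕ} {a b : ℝ} (h0 : 0 < gridIndex m a)
    (h1 : gridIndex m a + 1 < m) (hab : gridIndex m a = gridIndex m b) :
    |a - b| * m < 1 := by
  have ha := le_of_le_gridIndex h0 le_rfl
  have hb := le_of_le_gridIndex h0 hab.le
  have ha' := lt_of_gridIndex_lt h1 (Nat.lt_succ_self _)
  have hb' := lt_of_gridIndex_lt h1 (hab.symm.le.trans_lt (Nat.lt_succ_self _))
  push_cast at ha' hb'
  rw [← abs_of_nonneg (Nat.cast_nonneg m : (0 : ℝ) ≤ m), ← abs_mul, abs_lt]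
  constructor <;> nlinarith

/-- Numbers in the middle half of an interval of the coarse grid are far from all numbers in
other intervals of the coarse grid. -/
theorem le_abs_sub_of_gridIndex_div_ne {k t : ℕ} (ht : 0 < t) {a b : ℝ}
    (h1 : t ≤ gridIndex (k * (4 * t)) a % (4 * t))
    (h2 : gridIndex (k * (4 * t)) a % (4 * t) < 3 * t)
    (hne : gridIndex (k * (4 * t)) a / (4 * t) ≠ gridIndex (k * (4 * t)) b / (4 * t)) :
    (t : ℝ) ≤ |a - b| * (k * (4 * t) : ℕ) := by
  rcases Nat.eq_zero_or_pos k with rfl | hk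
  · simp [gridIndex] at hne
  set m := k * (4 * t) with hm
  set c := gridIndex m a / (4 * t) with hc
  have hmpos : 0 < m := by positivity
  have hadm := Nat.div_add_mod (gridIndex m a) (4 * t)
  have hbdm := Nat.div_add_mod (gridIndex m b) (4 * t)
  rw [← hc] at hadm
  set q := gridIndex m b / (4 * t) with hq
  have hck : c < k := Nat.div_lt_of_lt_mul (by rw [mul_comm]; exact gridIndex_lt hmpos a)
  have hckm : 4 * t * c + 4 * t ≤ m := by
    rw [hm]; nlinarith
  -- In units of `1 / m`, the coarse interval of `a` is `[4tc, 4tc + 4t)`, and `a` keeps distance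
  -- `t` from both ends.
  have ha1 : ((4 * t * c + t : ℕ) : ℝ) ≤ a * m := le_of_le_gridIndex (by omega) (by omega)
  have ha2 : a * m < ((4 * t * c + 3 * t : ℕ) : ℝ) := lt_of_gridIndex_lt (by omega) (by omega)
  push_cast at ha1 ha2
  have habs : ∀ y : ℝ, |y| * m = |y * m| := fun y => by
    rw [abs_mul, abs_of_nonneg (Nat.cast_nonneg m : (0 : ℝ) ≤ m)]
  rw [habs, sub_mul]
  have hbmod := Nat.mod_lt (gridIndex m b) (show 0 < 4 * t by omega)
  rcases lt_or_gt_of_ne hne with h | h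
  · have hb1 : ((4 * t * c + 4 * t : ℕ) : ℝ) ≤ b * m := by
      refine le_of_le_gridIndex (by omega) ?_
      have : 4 * t * (c + 1) ≤ 4 * t * q := Nat.mul_le_mul_left _ h
      have := Nat.le.intro hbdm
      linarith
    push_cast at hb1
    rw [abs_sub_comm]
    refine le_trans ?_ (le_abs_self _)
    linarith
  · have hb2 : b * m < ((4 * t * c : ℕ) : ℝ) := by
      refine lt_of_gridIndex_lt (by omega) ?_
      have : 4 * t * (q + 1) ≤ 4 * t * c := Nat.mul_le_mul_left _ h
      linarith
    push_cast at hb2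
    refine le_trans ?_ (le_abs_self _)
    linarith

/-! ### A variance bound for functions with bounded differences -/

/-- In unnormalized form, the variance is at most `n d²`. Induction by the law of total variance:
fixing the first coordinate leaves a function of `n` coordinates, and the conditional means `g`
differ pairwise by at most `d`, hence from `m` by at most `d`. -/
theorem sum_sq_sub_mean_le {α : Type*} [Fintype α] [Nonempty α] {d : ℝ} :
    ∀ {n : ℕ} (f : (Fin n → α) → ℝ),
      (∀ x i a, |f (Function.update x i a) - f x| ≤ d) →
      ∑ x, (f x - (∑ y, f y) / (Fintype.card α : ℝ) ^ n) ^ 2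
        ≤ n * d ^ 2 * (Fintype.card α : ℝ) ^ n := by
  intro n
  induction n with
  | zero => intro f _; simp
  | succ n ih =>
    intro f hf
    have hK : (0 : ℝ) < Fintype.card α := by exact_mod_cast Fintype.card_pos
    have hKn : (0 : ℝ) < (Fintype.card α : ℝ) ^ n := pow_pos hK n
    have hsplit : ∀ g : (Fin (n + 1) → α) → ℝ,
        ∑ x, g x = ∑ a, ∑ x : Fin n → α, g (Fin.cons a x) := by
      intro g
      rw [← Fintype.sum_prod_type']
      exact (Fintype.sum_equiv (Fin.consEquiv fun _ => α) _ _ fun x => rfl).symm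
    set g : α → ℝ := fun a => (∑ x : Fin n → α, f (Fin.cons a x)) / (Fintype.card α : ℝ) ^ n with hg
    set m : ℝ := (∑ y, f y) / (Fintype.card α : ℝ) ^ (n + 1) with hm
    have hgs : ∀ a, ∑ x : Fin n → α, f (Fin.cons a x) = g a * (Fintype.card α : ℝ) ^ n := by
      intro a; rw [hg]; field_simp
    have hmg : m * Fintype.card α = ∑ a, g a := by
      rw [hm, hsplit, hg, ← Finset.sum_div, pow_succ]; field_simp
    have hgd : ∀ a b, |g a - g b| ≤ d := by
      intro a b
      rw [hg]
      simp only
      rw [← sub_div, ← Finset.sum_sub_distrib, abs_div, abs_of_pos hKn, div_le_iff₀ hKn]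
      refine (Finset.abs_sum_le_sum_abs _ _).trans ?_
      refine (Finset.sum_le_sum fun x _ => (?_ : _ ≤ d)).trans (le_of_eq ?_)
      · have := hf (Fin.cons b x : Fin (n + 1) → α) 0 a
        rwa [Fin.update_cons_zero] at this
      · simp [mul_comm]
    have hgm : ∀ a, (g a - m) ^ 2 ≤ d ^ 2 := by
      intro a
      rw [← sq_abs]
      have : |g a - m| ≤ d := by
        have h1 : (g a - m) * Fintype.card α = ∑ b, (g a - g b) := by
          rw [sub_mul, hmg, Finset.sum_sub_distrib]; simp [mul_comm]
        have h2 : |g a - m| * Fintype.card α ≤ d * Fintype.card α := by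
          rw [← abs_of_pos hK, ← abs_mul, abs_of_pos hK, h1]
          refine (Finset.abs_sum_le_sum_abs _ _).trans ?_
          refine (Finset.sum_le_sum fun b _ => hgd a b).trans (le_of_eq ?_)
          simp [mul_comm]
        exact le_of_mul_le_mul_right h2 hK
      gcongr
    have hstep : ∀ a, ∑ x : Fin n → α, (f (Fin.cons a x) - m) ^ 2
        ≤ (n + 1) * d ^ 2 * (Fintype.card α : ℝ) ^ n := by
      intro a
      have h1 := ih (fun x => f (Fin.cons a x)) (fun x i b => by
        have := hf (Fin.cons a x : Fin (n + 1) → α) i.succ b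
        rwa [← Fin.cons_update] at this)
      -- The cross term vanishes because `g a` is the mean of `f` on this slice.
      have h2 : ∑ x : Fin n → α, (f (Fin.cons a x) - m) ^ 2
          = ∑ x : Fin n → α, (f (Fin.cons a x) - g a) ^ 2
            + (g a - m) ^ 2 * (Fintype.card α : ℝ) ^ n := by
        have h3 : ∀ x : Fin n → α, (f (Fin.cons a x) - m) ^ 2 = (f (Fin.cons a x) - g a) ^ 2
            + (2 * (g a - m) * f (Fin.cons a x) + (m ^ 2 - g a ^ 2)) := fun x => by ring
        rw [Finset.sum_congr rfl fun x _ => h3 x, Finset.sum_add_distrib, Finset.sum_add_distrib,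
          ← Finset.mul_sum, hgs]
        simp
        ring
      have h4 := mul_le_mul_of_nonneg_right (hgm a) hKn.le
      change ∑ x : Fin n → α, (f (Fin.cons a x) - g a) ^ 2 ≤ _ at h1
      rw [h2]
      linarith
    rw [hsplit]
    refine (Finset.sum_le_sum fun a _ => hstep a).trans (le_of_eq ?_)
    simp
    ring

/-! ### The number of boxes containing exactly two balls -/

section Boxes
variable {γ : Type*} [Fintype γ] [DecidableEq γ]

/-- The boxes that contain exactly two balls, where ball `i` is in box `c i`. -/
def twoBallBoxes {n : ℕ} (c : Fin n → γ) : Finset γ :=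
  Finset.univ.filter fun j => (Finset.univ.filter fun i => c i = j).card = 2

/-- Moving one ball changes the occupancy of its old and new box only. -/
theorem twoBallBoxes_update_subset {n : ℕ} (c : Fin n → γ) (i : Fin n) (a : γ) :
    twoBallBoxes (Function.update c i a) ⊆ twoBallBoxes c ∪ {a, c i} := by
  intro j hj
  by_cases h1 : j = a
  · simp [h1]
  by_cases h2 : j = c i
  · simp [h2]
  simp only [twoBallBoxes, Finset.mem_union, Finset.mem_filter, Finset.mem_univ, true_and] at hj ⊢
  left
  rw [← hj]
  congr 1
  ext i'
  by_cases h : i' = i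
  · subst h; simp [Ne.symm h1, Ne.symm h2]
  · simp [h]

theorem abs_card_twoBallBoxes_update_sub_le {n : ℕ} (c : Fin n → γ) (i : Fin n) (a : γ) :
    |((twoBallBoxes (Function.update c i a)).card : ℝ) - (twoBallBoxes c).card| ≤ 2 := by
  have key : ∀ (c : Fin n → γ) (a : γ),
      (twoBallBoxes (Function.update c i a)).card ≤ (twoBallBoxes c).card + 2 := fun c a =>
    (Finset.card_le_card (twoBallBoxes_update_subset c i a)).trans
      ((Finset.card_union_le _ _).trans (Nat.add_le_add_left Finset.card_le_two _))
  have h1 := key c a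
  have h2 := key (Function.update c i a) (c i)
  rw [Function.update_idem, Function.update_eq_self] at h2
  rw [abs_le]
  have h1' : ((twoBallBoxes (Function.update c i a)).card : ℝ) ≤ (twoBallBoxes c).card + 2 := by
    exact_mod_cast h1
  have h2' : ((twoBallBoxes c).card : ℝ) ≤ (twoBallBoxes (Function.update c i a)).card + 2 := by
    exact_mod_cast h2
  constructor <;> linarith

theorem card_filter_fiber_eq {n : ℕ} (j : γ) (T : Finset (Fin n)) :
    (Finset.univ.filter fun c : Fin n → γ => (Finset.univ.filter fun i => c i = j) = T).card
      = (Fintype.card γ - 1) ^ (n - T.card) := by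
  have : (Finset.univ.filter fun c : Fin n → γ => (Finset.univ.filter fun i => c i = j) = T)
      = Fintype.piFinset fun i => if i ∈ T then {j} else {j}ᶜ := by
    ext c
    simp only [Finset.mem_filter, Finset.mem_univ, true_and, Fintype.mem_piFinset,
      Finset.ext_iff]
    refine forall_congr' fun i => ?_
    by_cases h : i ∈ T <;> simp [h]
  rw [this, Fintype.card_piFinset]
  have h2 : ∀ i : Fin n, (if i ∈ T then ({j} : Finset γ) else {j}ᶜ).card
      = if i ∈ T then 1 else Fintype.card γ - 1 := by
    intro i; split_ifs <;> simp [Finset.card_compl]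
  rw [Finset.prod_congr rfl fun i _ => h2 i, Finset.prod_ite]
  simp [Finset.filter_not, ← Finset.compl_eq_univ_sdiff, Finset.card_compl]

/-- Double counting: pick the box, then its pair of balls; each other ball has `Fintype.card γ - 1`
boxes left. -/
theorem sum_card_twoBallBoxes (n : ℕ) :
    ∑ c : Fin n → γ, (twoBallBoxes c).card
      = Fintype.card γ * (n.choose 2 * (Fintype.card γ - 1) ^ (n - 2)) := by
  simp only [twoBallBoxes, Finset.card_filter]
  rw [Finset.sum_comm]
  have h : ∀ j : γ, (∑ c : Fin n → γ,
      if (∑ i, if c i = j then 1 else 0) = 2 then 1 else 0)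
      = n.choose 2 * (Fintype.card γ - 1) ^ (n - 2) := by
    intro j
    simp only [← Finset.card_filter]
    rw [Finset.card_eq_sum_card_fiberwise
      (f := fun c : Fin n → γ => Finset.univ.filter fun i => c i = j)
      (t := Finset.powersetCard 2 Finset.univ) (by
        intro c hc
        simpa [Finset.mem_powersetCard] using hc)]
    rw [Finset.sum_congr rfl (g := fun _ => (Fintype.card γ - 1) ^ (n - 2)) (by
      intro T hT
      have hT2 := (Finset.mem_powersetCard.1 hT).2
      rw [← hT2, ← card_filter_fiber_eq j T, Finset.filter_filter]
      congr 1
      ext c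
      simp only [Finset.mem_filter, Finset.mem_univ, true_and, and_iff_right_iff_imp]
      rintro rfl
      rfl)]
    simp
  rw [Finset.sum_congr rfl fun j _ => h j]
  simp

/-- With `K` boxes, `K ≥ 2n` and Bernoulli's inequality give `(1 - 1/K)^(n-2) ≥ 1/2`, while `K ≤ 8n`
bounds `n.choose 2 / K` below by `(n - 1) / 16 ≥ n / 32`. -/
theorem div_le_mean_card_twoBallBoxes {n : ℕ} (hn : 2 ≤ n) (h1 : 2 * n ≤ Fintype.card γ)
    (h2 : Fintype.card γ ≤ 8 * n) :
    (n : ℝ) / 64 ≤ (∑ c : Fin n → γ, ((twoBallBoxes c).card : ℝ)) / (Fintype.card γ : ℝ) ^ n := by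
  have hs := sum_card_twoBallBoxes (γ := γ) n
  generalize Fintype.card γ = K at *
  have hs' : (∑ c : Fin n → γ, ((twoBallBoxes c).card : ℝ))
      = K * ((n.choose 2 : ℝ) * ((K : ℝ) - 1) ^ (n - 2)) := by
    have : ((K - 1 : ℕ) : ℝ) = (K : ℝ) - 1 := by rw [Nat.cast_sub (by omega)]; simp
    rw [← this]
    exact_mod_cast hs
  obtain ⟨r, rfl⟩ := Nat.exists_eq_add_of_le' hn
  have hK : (0 : ℝ) < K := by exact_mod_cast (by omega : 0 < K)
  have hK1 : 2 * ((r : ℝ) + 2) ≤ K := by exact_mod_cast h1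
  have hK2 : (K : ℝ) ≤ 8 * (r + 2) := by exact_mod_cast h2
  rw [hs', Nat.cast_choose_two]
  have hB : (1 / 2 : ℝ) * K ^ r ≤ ((K : ℝ) - 1) ^ r := by
    have hb := one_add_mul_le_pow (a := -1 / (K : ℝ)) (by
      rw [le_div_iff₀ hK]; linarith) r
    have : (1 + -1 / (K : ℝ)) = (K - 1) / K := by field_simp; ring
    rw [this, div_pow, le_div_iff₀ (pow_pos hK r)] at hb
    refine le_trans ?_ hb
    have : (1 / 2 : ℝ) ≤ 1 + r * (-1 / K) := by
      have : (r : ℝ) / K ≤ 1 / 2 := by rw [div_le_iff₀ hK]; linarith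
      have h3 : (r : ℝ) * (-1 / K) = - (r / K) := by ring
      rw [h3]; linarith
    gcongr
  rw [le_div_iff₀ (pow_pos hK _), show r + 2 - 2 = r from rfl, pow_add]
  push_cast
  have hr : (0 : ℝ) ≤ r := Nat.cast_nonneg r
  calc ((r : ℝ) + 2) / 64 * (K ^ r * K ^ 2)
      = (K * ((r : ℝ) + 2) / 64 * K) * K ^ r := by ring
    _ ≤ (K * ((r : ℝ) + 2) / 64 * (8 * (r + 2))) * K ^ r := by gcongr
    _ ≤ (K * ((r + 2) * (r + 2 - 1) / 2)) * ((1 / 2) * K ^ r) := by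
      have : (r : ℝ) + 2 ≤ 2 * (r + 2 - 1) := by linarith
      have h5 : (0 : ℝ) ≤ K * (r + 2) / 8 * K ^ r := by positivity
      nlinarith [mul_le_mul_of_nonneg_left this h5]
    _ ≤ (K * ((r + 2) * (r + 2 - 1) / 2)) * ((K : ℝ) - 1) ^ r := by
      gcongr
      have : (0 : ℝ) ≤ r + 2 - 1 := by linarith
      positivity
    _ = _ := by ring

/-- With high probability a linear number of boxes contain exactly two balls. -/
theorem card_few_twoBallBoxes_le {n : ℕ} (hn : 2 ≤ n) (h1 : 2 * n ≤ Fintype.card γ)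
    (h2 : Fintype.card γ ≤ 8 * n) :
    ((Finset.univ.filter fun c : Fin n → γ => ((twoBallBoxes c).card : ℝ) < n / 128).card : ℝ)
      ≤ 65536 / n * (Fintype.card γ : ℝ) ^ n := by
  have : Nonempty γ := Fintype.card_pos_iff.1 (by omega)
  have hmean := div_le_mean_card_twoBallBoxes hn h1 h2
  have hvar := sum_sq_sub_mean_le (d := 2) (fun c : Fin n → γ => ((twoBallBoxes c).card : ℝ))
    (fun x i a => abs_card_twoBallBoxes_update_sub_le x i a)
  set m : ℝ := (∑ c : Fin n → γ, ((twoBallBoxes c).card : ℝ)) / (Fintype.card γ : ℝ) ^ n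
  have hn0 : (0 : ℝ) < n := by exact_mod_cast (by omega : 0 < n)
  set S := Finset.univ.filter fun c : Fin n → γ => ((twoBallBoxes c).card : ℝ) < n / 128
  -- Chebyshev: on `S` the count is at least `n / 128` below its mean, which is at least `n / 64`.
  -- With variance at most `4n` this yields `65536 = 4 * 128²`.
  have hcheb : (S.card : ℝ) * ((n : ℝ) / 128) ^ 2
      ≤ ∑ c : Fin n → γ, (((twoBallBoxes c).card : ℝ) - m) ^ 2 := by
    rw [← nsmul_eq_mul, ← Finset.sum_const]
    refine (Finset.sum_le_sum fun c hc => ?_).trans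
      (Finset.sum_le_sum_of_subset_of_nonneg (Finset.subset_univ S) fun c _ _ => sq_nonneg _)
    have hc' : ((twoBallBoxes c).card : ℝ) < n / 128 := (Finset.mem_filter.1 hc).2
    rw [← neg_sq (_ - m)]
    gcongr
    linarith
  have := hcheb.trans hvar
  have h3 : (S.card : ℝ) * (n : ℝ) ^ 2 ≤ 65536 * (Fintype.card γ : ℝ) ^ n * n := by
    nlinarith
  rw [div_mul_eq_mul_div, le_div_iff₀ hn0]
  refine le_of_mul_le_mul_right ?_ hn0
  nlinarith

end Boxes

/-! ### Boxes with two balls carrying the same admissible mark -/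

section GoodBoxes
variable {γ σ : Type*} [Fintype γ] [DecidableEq γ]

/-- Independence of the marks in different boxes: a marking of all balls is a family of markings of
the fibers of `c`. -/
theorem sum_pi_eq_sum_pi_fibers {n : ℕ} [Fintype σ] (c : Fin n → γ)
    (f : (j : γ) → ({i // c i = j} → σ) → ℝ) :
    ∑ s : Fin n → σ, ∏ j, f j (fun i => s i) = ∏ j, ∑ t : {i // c i = j} → σ, f j t := by
  rw [Finset.prod_univ_sum, Fintype.piFinset_univ]
  exact Fintype.sum_equiv
    (((Equiv.sigmaFiberEquiv c).symm.arrowCongr (Equiv.refl σ)).trans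
      (Equiv.piCurry fun (j : γ) (_ : {i // c i = j}) => σ)) _ _ fun s => rfl

variable [Fintype σ] [DecidableEq σ]

/-- The boxes that contain exactly two balls, both of which carry the same mark from `A`, where
ball `i` is in box `c i` and carries the mark `s i`. -/
def goodBoxes (A : Finset σ) {n : ℕ} (c : Fin n → γ) (s : Fin n → σ) : Finset γ :=
  Finset.univ.filter fun j => (Finset.univ.filter fun i => c i = j).card = 2 ∧
    ∃ a ∈ A, ∀ i, c i = j → s i = a

theorem sum_ite_const_mem {ι : Type*} [Fintype ι] [DecidableEq ι] (A : Finset σ) (p : ℝ)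
    (hι : Fintype.card ι = 2) :
    ∑ t : ι → σ, (if ∃ a ∈ A, ∀ i, t i = a then p else 1)
      = (Fintype.card σ : ℝ) ^ 2 - (1 - p) * A.card := by
  have : Nonempty ι := Fintype.card_pos_iff.1 (by omega)
  have hcard : (Finset.univ.filter fun t : ι → σ => ∃ a ∈ A, ∀ i, t i = a).card = A.card := by
    rw [← Finset.card_image_of_injective A (Function.const_injective (α := ι) (β := σ))]
    congr 1
    ext t
    simp only [Finset.mem_filter, Finset.mem_univ, true_and, Finset.mem_image, funext_iff,
      Function.const_apply, eq_comm]
  have h : ∀ t : ι → σ, (if ∃ a ∈ A, ∀ i, t i = a then p else 1)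
      = 1 - (1 - p) * (if ∃ a ∈ A, ∀ i, t i = a then 1 else 0) := by
    intro t; split_ifs <;> ring
  rw [Finset.sum_congr rfl fun t _ => h t, Finset.sum_sub_distrib, ← Finset.mul_sum,
    Finset.sum_boole, hcard]
  simp [hι]

/-- A two-ball box is good for `A.card` of its `(Fintype.card σ)²` mark pairs, and the weight `p ^
#good` is a product over boxes. -/
theorem sum_pow_card_goodBoxes [Nonempty σ] (A : Finset σ) (p : ℝ) {n : ℕ} (c : Fin n → γ) :
    ∑ s : Fin n → σ, p ^ (goodBoxes A c s).card
      = (Fintype.card σ : ℝ) ^ n *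
        (1 - (1 - p) * (A.card / (Fintype.card σ : ℝ) ^ 2)) ^ (twoBallBoxes c).card := by
  have hσ : (Fintype.card σ : ℝ) ≠ 0 := by exact_mod_cast Fintype.card_ne_zero
  have hfib : ∀ j, Fintype.card {i // c i = j} = (Finset.univ.filter fun i => c i = j).card :=
    fun j => Fintype.card_subtype _
  have h1 : ∀ s : Fin n → σ, p ^ (goodBoxes A c s).card = ∏ j, (fun (j : γ)
      (t : {i // c i = j} → σ) => if Fintype.card {i // c i = j} = 2 ∧ ∃ a ∈ A, ∀ i, t i = a
        then p else 1) j (fun i => s i) := by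
    intro s
    simp only [hfib, Subtype.forall]
    rw [goodBoxes, Finset.prod_ite]
    simp
  have h2 : ∀ j, ∑ t : {i // c i = j} → σ, (if Fintype.card {i // c i = j} = 2 ∧
      ∃ a ∈ A, ∀ i, t i = a then p else 1)
      = (Fintype.card σ : ℝ) ^ Fintype.card {i // c i = j} *
        (if (Finset.univ.filter fun i => c i = j).card = 2 then
          1 - (1 - p) * (A.card / (Fintype.card σ : ℝ) ^ 2) else 1) := by
    intro j
    by_cases h : Fintype.card {i // c i = j} = 2
    · rw [← hfib]
      simp only [h, true_and, if_true]
      rw [sum_ite_const_mem A p h]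
      field_simp
    · rw [← hfib]
      simp [h]
  rw [Finset.sum_congr rfl fun s _ => h1 s]
  refine (sum_pi_eq_sum_pi_fibers c (fun (j : γ) (t : {i // c i = j} → σ) =>
    if Fintype.card {i // c i = j} = 2 ∧ ∃ a ∈ A, ∀ i, t i = a then p else 1)).trans ?_
  rw [Finset.prod_congr rfl fun j _ => h2 j, Finset.prod_mul_distrib, Finset.prod_pow_eq_pow_sum,
    ← Fintype.card_sigma, Fintype.card_congr (Equiv.sigmaFiberEquiv c), Fintype.card_fin,
    Finset.prod_ite]
  simp [twoBallBoxes]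

/-- If each of the good boxes is accepted with probability `p`, then all are accepted with
exponentially small probability, up to a term of order `1 / n`. -/
theorem sum_sum_pow_card_goodBoxes_le [Nonempty σ] (A : Finset σ) {p : ℝ} (hp0 : 0 ≤ p)
    (hp1 : p ≤ 1) {n : ℕ} (hn : 2 ≤ n) (h1 : 2 * n ≤ Fintype.card γ)
    (h2 : Fintype.card γ ≤ 8 * n) :
    ∑ c : Fin n → γ, ∑ s : Fin n → σ, p ^ (goodBoxes A c s).card
      ≤ ((Fintype.card γ : ℝ) * Fintype.card σ) ^ n *
        (Real.exp (-((1 - p) * (A.card / (Fintype.card σ : ℝ) ^ 2) * (n / 128))) + 65536 / n) := by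
  set y := (1 - p) * (A.card / (Fintype.card σ : ℝ) ^ 2) with hy
  have hσ : (1 : ℝ) ≤ Fintype.card σ := by exact_mod_cast Fintype.card_pos
  have hA : (A.card : ℝ) ≤ Fintype.card σ := by exact_mod_cast A.card_le_univ
  have hy0 : 0 ≤ y := mul_nonneg (by linarith) (by positivity)
  have hy1 : y ≤ 1 := by
    refine mul_le_one₀ (by linarith) (by positivity) ?_
    rw [div_le_one (by positivity)]
    nlinarith
  -- Assignments with too few two-ball boxes are charged the trivial bound `1`.
  have hbound : ∀ c : Fin n → γ, (1 - y) ^ (twoBallBoxes c).card ≤ Real.exp (-(y * (n / 128)))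
      + if ((twoBallBoxes c).card : ℝ) < n / 128 then 1 else 0 := by
    intro c
    split_ifs with h
    · exact (pow_le_one₀ (by linarith) (by linarith)).trans (by linarith [Real.exp_pos (-(y * (n / 128)))])
    · rw [add_zero]
      calc (1 - y) ^ (twoBallBoxes c).card ≤ Real.exp (-y) ^ (twoBallBoxes c).card :=
            pow_le_pow_left₀ (by linarith) (Real.one_sub_le_exp_neg y) _
        _ = Real.exp (-(y * (twoBallBoxes c).card)) := by
            rw [← Real.exp_nat_mul]; congr 1; ring
        _ ≤ _ := by
            rw [Real.exp_le_exp, neg_le_neg_iff]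
            exact mul_le_mul_of_nonneg_left (not_lt.1 h) hy0
  rw [Finset.sum_congr rfl fun c _ => sum_pow_card_goodBoxes A p c, ← Finset.mul_sum, ← hy,
    mul_pow, mul_comm ((Fintype.card γ : ℝ) ^ n), mul_assoc]
  refine mul_le_mul_of_nonneg_left ?_ (by positivity)
  refine (Finset.sum_le_sum fun c _ => hbound c).trans ?_
  rw [Finset.sum_add_distrib, Finset.sum_boole]
  refine (add_le_add_right (card_few_twoBallBoxes_le hn h1 h2) _).trans (le_of_eq ?_)
  simp
  ring

end GoodBoxes

/-! ### Labels of random points -/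

/-- Intersecting with the unit square removes the unbounded parts of the clamped end intervals. Only
an upper bound is needed, for a union bound. -/
theorem uniformSquare_real_gridIndex_le {m : ℕ} (hm : 0 < m) (i : Fin 2 → ℕ) :
    uniformSquare.real {z | ∀ j, gridIndex m (z j) = i j} ≤ (1 / (m : ℝ)) ^ 2 := by
  have hm0 : (0 : ℝ) < m := by exact_mod_cast hm
  have hsub : {z : Plane | ∀ j, gridIndex m (z j) = i j} ∩ unitSquare
      ⊆ {z | ∀ j, z j ∈ Set.Icc ((i j : ℝ) / m) ((i j + 1 : ℝ) / m)} := by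
    rintro z ⟨hz, hz1⟩ j
    have h01 := hz1 j
    refine ⟨?_, ?_⟩
    · rw [div_le_iff₀ hm0]
      rcases Nat.eq_zero_or_pos (i j) with h | h
      · rw [h]; simpa using mul_nonneg h01.1 hm0.le
      · exact le_of_le_gridIndex h (hz j).ge
    · rw [le_div_iff₀ hm0]
      rcases Nat.lt_or_ge (i j + 1) m with h | h
      · have := lt_of_gridIndex_lt h (by rw [hz j]; exact Nat.lt_succ_self _)
        push_cast at this
        exact this.le
      · have h' : (m : ℝ) ≤ i j + 1 := by exact_mod_cast h
        nlinarith [h01.2]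
  have hvol : volume {z : Plane | ∀ j, z j ∈ Set.Icc ((i j : ℝ) / m) ((i j + 1 : ℝ) / m)}
      = ENNReal.ofReal ((1 / (m : ℝ)) ^ 2) := by
    rw [← (EuclideanSpace.volume_preserving_symm_measurableEquiv_toLp
      (Fin 2)).symm.measure_preimage_equiv]
    have h2 : (MeasurableEquiv.toLp 2 (Fin 2 → ℝ)).symm.symm ⁻¹'
        {z : Plane | ∀ j, z j ∈ Set.Icc ((i j : ℝ) / m) ((i j + 1 : ℝ) / m)}
        = Set.pi Set.univ fun j : Fin 2 => Set.Icc ((i j : ℝ) / m) ((i j + 1 : ℝ) / m) := by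
      ext f
      simp only [Set.mem_preimage, Set.mem_ofPred_eq, Set.mem_pi, Set.mem_univ, true_imp_iff]
      rfl
    rw [h2, volume_pi_pi]
    have h3 : ∀ j : Fin 2, ((i j : ℝ) + 1) / m - (i j : ℝ) / m = 1 / m := fun j => by ring
    simp only [Real.volume_Icc, h3]
    rw [Finset.prod_const, Finset.card_univ, Fintype.card_fin, ENNReal.ofReal_pow (by positivity)]
  have hmeas : MeasurableSet unitSquare := by
    have : unitSquare = ⋂ i : Fin 2, (fun z : Plane => z i) ⁻¹' Set.Icc (0 : ℝ) 1 := by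
      ext z; simp [unitSquare]
    rw [this]
    exact MeasurableSet.iInter fun i => measurableSet_Icc.preimage (by fun_prop)
  rw [measureReal_def, uniformSquare, Measure.restrict_apply' hmeas]
  exact ENNReal.toReal_le_of_le_ofReal (by positivity) ((measure_mono hsub).trans hvol.le)

/-- The set of points in cell `c` of the coarse grid and in subcell `s` of that cell. -/
def subcell {k l : ℕ} (c : Fin 2 → Fin k) (s : Fin 2 → Fin l) : Set Plane :=
  {z | ∀ j, gridIndex (k * l) (z j) = l * c j + s j}

theorem uniformSquare_real_subcell_le {k l : ℕ} (hk : 0 < k) (hl : 0 < l) (c : Fin 2 → Fin k)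
    (s : Fin 2 → Fin l) : uniformSquare.real (subcell c s) ≤ (1 / ((k : ℝ) * l)) ^ 2 := by
  have := uniformSquare_real_gridIndex_le (m := k * l) (by positivity) (fun j => l * c j + s j)
  simpa [subcell] using this

theorem exists_mem_subcell {k l : ℕ} (hk : 0 < k) (hl : 0 < l) (z : Plane) :
    ∃ (c : Fin 2 → Fin k) (s : Fin 2 → Fin l), z ∈ subcell c s :=
  ⟨fun j => ⟨gridIndex (k * l) (z j) / l,
      Nat.div_lt_of_lt_mul (by rw [mul_comm]; exact gridIndex_lt (by positivity) _)⟩,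
    fun j => ⟨gridIndex (k * l) (z j) % l, Nat.mod_lt _ hl⟩, fun j => (Nat.div_add_mod _ _).symm⟩

/-- The subcells in the middle of a cell. -/
def middle (t : ℕ) : Finset (Fin 2 → Fin (4 * t)) :=
  Fintype.piFinset fun _ => (Finset.Ico t (3 * t)).attachFin fun i hi => by
    have := Finset.mem_Ico.1 hi
    omega

theorem mem_middle {t : ℕ} {s : Fin 2 → Fin (4 * t)} :
    s ∈ middle t ↔ ∀ j, t ≤ (s j : ℕ) ∧ (s j : ℕ) < 3 * t := by
  simp only [middle, Fintype.mem_piFinset, Finset.mem_attachFin, Finset.mem_Ico]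

theorem card_middle (t : ℕ) : (middle t).card = (2 * t) ^ 2 := by
  rw [middle, Fintype.card_piFinset]
  simp [Finset.card_attachFin]
  omega

theorem dist_mul_le_of_mem_subcell {k t : ℕ} (ht : 0 < t) {c : Fin 2 → Fin k}
    {s : Fin 2 → Fin (4 * t)} (hs : s ∈ middle t) {y z : Plane} (hy : y ∈ subcell c s)
    (hz : z ∈ subcell c s) : dist y z * (k * (4 * t) : ℕ) ≤ 2 := by
  have h : ∀ j, |y j - z j| * (k * (4 * t) : ℕ) < 1 := by
    intro j
    have hsj := mem_middle.1 hs j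
    have hc : (c j : ℕ) + 1 ≤ k := (c j).2
    refine abs_sub_lt_of_gridIndex_eq ?_ ?_ ((hy j).trans (hz j).symm)
    · rw [hy j]; omega
    · rw [hy j]; nlinarith
  have hd : dist y z ≤ |y 0 - z 0| + |y 1 - z 1| := by
    rw [EuclideanSpace.dist_eq, Fin.sum_univ_two, Real.dist_eq, Real.dist_eq]
    refine Real.sqrt_le_iff.2 ⟨by positivity, ?_⟩
    nlinarith [abs_nonneg (y 0 - z 0), abs_nonneg (y 1 - z 1)]
  have := mul_le_mul_of_nonneg_right hd (Nat.cast_nonneg (α := ℝ) (k * (4 * t)))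
  linarith [h 0, h 1]

/-- One coordinate in which the cells differ already separates the points; only `y` has to lie in
the middle. -/
theorem le_dist_mul_of_mem_subcell {k t : ℕ} (ht : 0 < t) {c c' : Fin 2 → Fin k}
    {s s' : Fin 2 → Fin (4 * t)} (hs : s ∈ middle t) {y z : Plane} (hy : y ∈ subcell c s)
    (hz : z ∈ subcell c' s') (hc : c ≠ c') : (t : ℝ) ≤ dist y z * (k * (4 * t) : ℕ) := by
  obtain ⟨j, hj⟩ := Function.ne_iff.1 hc
  have hdiv : ∀ {x : Plane} {d : Fin 2 → Fin k} {r : Fin 2 → Fin (4 * t)}, x ∈ subcell d r →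
      gridIndex (k * (4 * t)) (x j) / (4 * t) = d j ∧
      gridIndex (k * (4 * t)) (x j) % (4 * t) = r j := by
    intro x d r hx
    rw [hx j]
    exact ⟨by rw [Nat.mul_add_div (by omega), Nat.div_eq_of_lt (r j).2, add_zero],
      by rw [Nat.mul_add_mod, Nat.mod_eq_of_lt (r j).2]⟩
  have hsj := mem_middle.1 hs j
  have h := le_abs_sub_of_gridIndex_div_ne (k := k) (a := y j) (b := z j) ht
    (by rw [(hdiv hy).2]; exact hsj.1) (by rw [(hdiv hy).2]; exact hsj.2)
    (by rw [(hdiv hy).1, (hdiv hz).1]; exact fun h => hj (Fin.ext h))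
  refine h.trans (mul_le_mul_of_nonneg_right ?_ (Nat.cast_nonneg _))
  have := PiLp.dist_apply_le y z j
  rwa [Real.dist_eq] at this

/-- In a graph of small stretch the two points in a good box are adjacent. -/
theorem adj_of_stretchFactor_lt {n k t : ℕ} (hk : 0 < k) (ht : 0 < t) {lam : ℝ} (hlam : 0 ≤ lam)
    (hlt : 2 * lam ≤ t) {c : Fin n → Fin 2 → Fin k} {s : Fin n → Fin 2 → Fin (4 * t)}
    {x : Fin n → Plane} (hx : ∀ i, x i ∈ subcell (c i) (s i)) {G : SimpleGraph (Fin n)}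
    (hG : stretchFactor x G < ENNReal.ofReal lam) {j : Fin 2 → Fin k}
    (hj : j ∈ goodBoxes (middle t) c s) {u v : Fin n} (huv : u ≠ v) (hu : c u = j) (hv : c v = j) :
    G.Adj u v := by
  by_contra hadj
  obtain ⟨hcard, a, ha, hsa⟩ := (Finset.mem_filter.1 hj).2
  have hm : (0 : ℝ) < (k * (4 * t) : ℕ) := by positivity
  refine not_lt.2 (le_stretchFactor_of_not_adj x G huv hadj (r := t / (k * (4 * t) : ℕ))
    (by positivity) hlam ?_ ?_) hG
  · have h1 := dist_mul_le_of_mem_subcell ht ha (hsa u hu ▸ hu ▸ hx u) (hsa v hv ▸ hv ▸ hx v)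
    rw [le_div_iff₀ hm, mul_assoc]
    exact (mul_le_mul_of_nonneg_left h1 hlam).trans (by linarith)
  · intro w hwu hwv
    rw [div_le_iff₀ hm]
    refine le_dist_mul_of_mem_subcell ht ((hsa u hu).symm ▸ ha) (hx u) (hx w) ?_
    -- A third point in the cell would contradict that it holds exactly two.
    intro hcw
    have h3 : ({u, v, w} : Finset (Fin n)) ⊆ Finset.univ.filter fun i => c i = j := by
      intro i hi
      simp only [Finset.mem_insert, Finset.mem_singleton] at hi
      rcases hi with rfl | rfl | rfl <;> simp_all
    have := Finset.card_le_card h3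
    rw [hcard, Finset.card_eq_three.2 ⟨u, v, w, huv, hwu.symm, hwv.symm, rfl⟩] at this
    omega

/-- Pairs in different boxes are disjoint, so the required edges are distinct and independent. -/
theorem binomialRandom_real_adj_goodBoxes_le {γ σ : Type*} [Fintype γ] [DecidableEq γ]
    [Fintype σ] [DecidableEq σ] {n : ℕ} (p : unitInterval) (A : Finset σ)
    (c : Fin n → γ) (s : Fin n → σ) :
    (SimpleGraph.binomialRandom (Fin n) p).real
      {G | ∀ j ∈ goodBoxes A c s, ∀ u v, u ≠ v → c u = j → c v = j → G.Adj u v}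
      ≤ (p : ℝ) ^ (goodBoxes A c s).card := by
  have h : ∀ j : goodBoxes A c s, ∃ e : Fin n × Fin n, e.1 ≠ e.2 ∧ c e.1 = j ∧ c e.2 = j := by
    rintro ⟨j, hj⟩
    obtain ⟨u, v, huv, h⟩ := Finset.card_eq_two.1 (Finset.mem_filter.1 hj).2.1
    have hu : u ∈ Finset.univ.filter fun i => c i = j := by simp [h]
    have hv : v ∈ Finset.univ.filter fun i => c i = j := by simp [h]
    exact ⟨(u, v), huv, (Finset.mem_filter.1 hu).2, (Finset.mem_filter.1 hv).2⟩
  choose e he1 he2 he3 using h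
  have := binomialRandom_real_adj p Finset.univ (fun j => (e j).1) (fun j => (e j).2)
    (fun j _ => he1 j) (by
      intro i _ j _ hij
      have : (e i).1 ∈ s((e j).1, (e j).2) := hij ▸ Sym2.mem_mk_left _ _
      refine Subtype.ext ?_
      rcases Sym2.mem_iff.1 this with h | h
      · rw [← he2 i, h, he2 j]
      · rw [← he2 i, h, he3 j])
  rw [Finset.card_univ, Fintype.card_coe] at this
  rw [← this]
  exact measureReal_mono fun G hG j _ => hG j j.2 _ _ (he1 j) (he2 j) (he3 j)

instance (n : ℕ) (p : unitInterval) : IsProbabilityMeasure (embeddedGraphLaw n p) := by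
  unfold embeddedGraphLaw; infer_instance

/-- A union bound over all cell and subcell labels replaces conditioning on the positions, and
avoids measurability of the stretch event. -/
theorem embeddedGraphLaw_real_stretchFactor_lt_le_sum {n k t : ℕ} (hk : 0 < k) (ht : 0 < t)
    (p : unitInterval) {lam : ℝ} (hlam : 0 ≤ lam) (hlt : 2 * lam ≤ t) :
    (embeddedGraphLaw n p).real {ω | stretchFactor ω.1 ω.2 < ENNReal.ofReal lam}
      ≤ ∑ c : Fin n → Fin 2 → Fin k, ∑ s : Fin n → Fin 2 → Fin (4 * t),
        ((1 / ((k : ℝ) * (4 * t : ℕ))) ^ 2) ^ n * (p : ℝ) ^ (goodBoxes (middle t) c s).card := by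
  have hsub : {ω : (Fin n → Plane) × SimpleGraph (Fin n) |
        stretchFactor ω.1 ω.2 < ENNReal.ofReal lam}
      ⊆ ⋃ c ∈ (Finset.univ : Finset (Fin n → Fin 2 → Fin k)),
        ⋃ s ∈ (Finset.univ : Finset (Fin n → Fin 2 → Fin (4 * t))),
        (Set.pi Set.univ fun i => subcell (c i) (s i)) ×ˢ
          {G | ∀ j ∈ goodBoxes (middle t) c s, ∀ u v, u ≠ v → c u = j → c v = j → G.Adj u v} := by
    rintro ⟨x, G⟩ hG
    choose c s hx using fun i => exists_mem_subcell (l := 4 * t) hk (by omega) (x i)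
    simp only [Set.mem_iUnion, Finset.mem_univ, exists_prop, true_and]
    exact ⟨c, s, fun i _ => hx i, fun j hj u v huv hu hv =>
      adj_of_stretchFactor_lt hk ht hlam hlt hx hG hj huv hu hv⟩
  refine (measureReal_mono hsub (measure_ne_top _ _)).trans ?_
  refine (measureReal_biUnion_finset_le _ _).trans (Finset.sum_le_sum fun c _ => ?_)
  refine (measureReal_biUnion_finset_le _ _).trans (Finset.sum_le_sum fun s _ => ?_)
  rw [embeddedGraphLaw, measureReal_prod_prod]
  refine mul_le_mul ?_ (binomialRandom_real_adj_goodBoxes_le p _ c s) measureReal_nonneg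
    (by positivity)
  rw [measureReal_def, Measure.pi_pi, ENNReal.toReal_prod]
  refine (Finset.prod_le_prod (fun _ _ => ENNReal.toReal_nonneg) fun i _ =>
    uniformSquare_real_subcell_le hk (by omega) (c i) (s i)).trans (le_of_eq ?_)
  simp

/-- The middle has density `(2t)² / (4t)⁴ = 1 / (64 t²)` among mark pairs and `t = ⌈2 lam⌉ ≤ 3 lam`,
so the constant is `73728 = 64 * 9 * 128`. -/
theorem embeddedGraphLaw_real_stretchFactor_lt_le {n : ℕ} (hn : 2 ≤ n) (p : unitInterval) {lam : ℝ}
    (hlam : 1 ≤ lam) :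
    (embeddedGraphLaw n p).real {ω | stretchFactor ω.1 ω.2 < ENNReal.ofReal lam}
      ≤ Real.exp (-(n * (1 - (p : ℝ)) / (73728 * lam ^ 2))) + 65536 / n := by
  set k := Nat.sqrt (2 * n) + 1 with hk
  set t := ⌈2 * lam⌉₊ with htdef
  have ht : 0 < t := Nat.ceil_pos.2 (by linarith)
  have ht3 : (t : ℝ) ≤ 3 * lam := by
    have := Nat.ceil_lt_add_one (show 0 ≤ 2 * lam by linarith)
    linarith
  have hk1 : 2 * n ≤ k ^ 2 := by
    have := Nat.lt_succ_sqrt (2 * n)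
    rw [hk, sq]; exact this.le
  have hk2 : k ^ 2 ≤ 8 * n := by
    have h1 := Nat.sqrt_le (2 * n)
    have h2 : 1 ≤ Nat.sqrt (2 * n) := Nat.sqrt_pos.2 (by omega)
    rw [hk]; nlinarith
  have : NeZero t := ⟨ht.ne'⟩
  have hcell : Fintype.card (Fin 2 → Fin k) = k ^ 2 := by simp
  have hsub : Fintype.card (Fin 2 → Fin (4 * t)) = (4 * t) ^ 2 := by simp
  have h := sum_sum_pow_card_goodBoxes_le (γ := Fin 2 → Fin k) (middle t) p.2.1 p.2.2 hn
    (by rw [hcell]; exact hk1) (by rw [hcell]; exact hk2)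
  refine (embeddedGraphLaw_real_stretchFactor_lt_le_sum (k := k) (by omega) ht p (by linarith)
    (Nat.le_ceil _)).trans ?_
  simp only [← Finset.mul_sum]
  refine (mul_le_mul_of_nonneg_left h (by positivity)).trans ?_
  have hkr : (0 : ℝ) < k := by positivity
  have htr : (0 : ℝ) < t := by positivity
  rw [hcell, hsub, card_middle, ← mul_assoc, ← mul_pow]
  have h1 : (1 / ((k : ℝ) * (4 * t : ℕ))) ^ 2 * (((k ^ 2 : ℕ) : ℝ) * ((4 * t) ^ 2 : ℕ)) = 1 := by
    push_cast
    field_simp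
  rw [h1, one_pow, one_mul]
  gcongr
  have h2 : ((((2 * t) ^ 2 : ℕ) : ℝ) / (((4 * t) ^ 2 : ℕ) : ℝ) ^ 2) = 1 / (64 * t ^ 2) := by
    push_cast
    field_simp
    norm_num
  rw [h2]
  have hq : 0 ≤ 1 - (p : ℝ) := by linarith [p.2.2]
  calc (n : ℝ) * (1 - (p : ℝ)) / (73728 * lam ^ 2)
      = (1 - (p : ℝ)) * (1 / (64 * (3 * lam) ^ 2)) * (n / 128) := by
        have : lam ≠ 0 := by linarith
        field_simp
        ring
    _ ≤ _ := by gcongr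

/-! ### The stretch factor is almost surely at least one -/

theorem pi_uniformSquare_eq_null {n : ℕ} {a b : Fin n} (hab : a ≠ b) :
    (Measure.pi fun _ : Fin n => uniformSquare) {x | x a = x b} = 0 := by
  have h : (volume : Measure (Fin n → Plane)) {x | x a = x b} = 0 := by
    let S : Submodule ℝ (Fin n → Plane) :=
      LinearMap.ker ((LinearMap.proj a : (Fin n → Plane) →ₗ[ℝ] Plane) - LinearMap.proj b)
    have hS : (S : Set (Fin n → Plane)) = {x | x a = x b} := by
      ext x; simp [S, sub_eq_zero]
    rw [← hS]
    refine Measure.addHaar_submodule _ S fun htop => ?_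
    have hmem : (Pi.single a (EuclideanSpace.single 0 1) : Fin n → Plane) ∈ S := by
      rw [htop]; trivial
    simp [S, hab.symm] at hmem
  have hr : (Measure.pi fun _ : Fin n => uniformSquare)
      = (volume : Measure (Fin n → Plane)).restrict (Set.univ.pi fun _ => unitSquare) :=
    (Measure.restrict_pi_pi _ _).symm
  rw [hr]
  exact Measure.absolutelyContinuous_of_le Measure.restrict_le_self h

/-- Two points almost surely differ, and then the stretch is at least one. This covers small `lam`,
where `⌈2 lam⌉ ≤ 3 lam` may fail. -/
theorem embeddedGraphLaw_real_stretchFactor_lt_one {n : ℕ} (hn : 2 ≤ n) (p : unitInterval)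
    {lam : ℝ} (hlam : lam ≤ 1) :
    (embeddedGraphLaw n p).real {ω | stretchFactor ω.1 ω.2 < ENNReal.ofReal lam} = 0 := by
  have hab : (⟨0, by omega⟩ : Fin n) ≠ ⟨1, by omega⟩ := by simp
  have hsub : {ω : (Fin n → Plane) × SimpleGraph (Fin n) |
      stretchFactor ω.1 ω.2 < ENNReal.ofReal lam}
      ⊆ {x | x ⟨0, by omega⟩ = x ⟨1, by omega⟩} ×ˢ Set.univ := by
    rintro ⟨x, G⟩ hG
    refine ⟨?_, trivial⟩
    by_contra hne
    exact absurd (lt_of_lt_of_le hG (ENNReal.ofReal_le_one.2 hlam))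
      (not_lt.2 (one_le_stretchFactor x G hne))
  rw [measureReal_def, measure_mono_null hsub, ENNReal.toReal_zero]
  rw [embeddedGraphLaw, Measure.prod_prod, pi_uniformSquare_eq_null hab, zero_mul]

/-! ### The tail bound and its consequences -/

theorem embeddedGraphLaw_real_stretchFactor_lt_le_exp {c : ℝ}
    (hc : c < 1 / (16 * Real.pi)) (n : ℕ) (p : unitInterval) {lam : ℝ} (hlam : 0 < lam) :
    (embeddedGraphLaw n p).real {ω | stretchFactor ω.1 ω.2 < ENNReal.ofReal lam}
      ≤ Real.exp (-(c * n * (1 - (p : ℝ)) / (2 * Real.exp 8 * lam ^ 2))) + 131072 / (n + 1) := by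
  have hexp := Real.exp_pos (-(c * n * (1 - (p : ℝ)) / (2 * Real.exp 8 * lam ^ 2)))
  rcases Nat.lt_or_ge n 2 with hn | hn
  -- For `n < 2` the error term exceeds `1` and the bound is trivial.
  · have h1 : (n : ℝ) + 1 ≤ 131072 := by
      have : (n : ℝ) < 2 := by exact_mod_cast hn
      linarith
    have h2 : 1 ≤ 131072 / ((n : ℝ) + 1) := by rwa [le_div_iff₀ (by positivity), one_mul]
    exact (measureReal_le_one).trans (by linarith)
  rcases lt_or_ge lam 1 with hl | hl
  · rw [embeddedGraphLaw_real_stretchFactor_lt_one hn p hl.le]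
    positivity
  refine (embeddedGraphLaw_real_stretchFactor_lt_le hn p hl).trans ?_
  have hn1 : (2 : ℝ) ≤ n := by exact_mod_cast hn
  have hc' : c ≤ 1 / 48 := by
    refine hc.le.trans (one_div_le_one_div_of_le (by norm_num) ?_)
    linarith [Real.pi_gt_three]
  -- Chosen so that `c * 73728 ≤ 73728 / 48 = 2 * 768 ≤ 2 * exp 8`.
  have he : (768 : ℝ) ≤ Real.exp 8 := by
    have h1 : Real.exp 8 = Real.exp 1 ^ 8 := by rw [← Real.exp_nat_mul]; norm_num
    have h2 : (2.7 : ℝ) ≤ Real.exp 1 := by linarith [Real.exp_one_gt_d9]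
    rw [h1]
    exact le_trans (by norm_num) (pow_le_pow_left₀ (by norm_num) h2 8)
  have hq : 0 ≤ 1 - (p : ℝ) := by linarith [p.2.2]
  refine add_le_add (Real.exp_le_exp.2 (neg_le_neg ?_)) ?_
  · rw [div_le_div_iff₀ (by positivity) (by positivity)]
    have h1 : c * 73728 ≤ 2 * Real.exp 8 := by linarith
    have h2 : 0 ≤ n * (1 - (p : ℝ)) * lam ^ 2 := by positivity
    nlinarith [mul_le_mul_of_nonneg_left h1 h2]
  · rw [div_le_div_iff₀ (by positivity) (by positivity)]
    linarith

theorem tendsto_const_div_natCast_add_one (C : ℝ) :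
    Tendsto (fun n : ℕ => C / ((n : ℝ) + 1)) atTop (𝓝 0) :=
  tendsto_const_nhds.div_atTop (tendsto_atTop_add_const_right _ _ tendsto_natCast_atTop_atTop)

/-- If `n (1 - p)` is bounded below, the stretch factor exceeds any given constant with
probability bounded below. -/
theorem exists_embeddedGraphLaw_real_stretchFactor_lt_le {p : ℕ → unitInterval} {a : ℝ}
    (ha : 0 < a) (hp : ∀ᶠ n : ℕ in atTop, a ≤ n * (1 - (p n : ℝ))) {lam : ℝ} (hlam : 0 < lam) :
    ∃ δ : ℝ, 0 < δ ∧ ∀ᶠ n : ℕ in atTop, (embeddedGraphLaw n (p n)).real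
      {ω | stretchFactor ω.1 ω.2 < ENNReal.ofReal lam} ≤ 1 - δ := by
  set b : ℝ := 1 / 51 * a / (2 * Real.exp 8 * lam ^ 2) with hb
  have hb0 : 0 < b := by positivity
  have hlt : Real.exp (-b) < 1 := by simpa using hb0
  -- Half of the gap `1 - exp (-b)`; the other half absorbs the error term.
  refine ⟨(1 - Real.exp (-b)) / 2, by linarith, ?_⟩
  have hsmall := (tendsto_const_div_natCast_add_one 131072).eventually_lt_const
    (show 0 < (1 - Real.exp (-b)) / 2 by linarith)
  filter_upwards [hp, hsmall] with n hn hs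
  have hpi : (1 / 51 : ℝ) < 1 / (16 * Real.pi) :=
    one_div_lt_one_div_of_lt (by positivity) (by linarith [Real.pi_lt_d2])
  have h := embeddedGraphLaw_real_stretchFactor_lt_le_exp hpi n (p n) hlam
  have h2 : Real.exp (-(1 / 51 * n * (1 - (p n : ℝ)) / (2 * Real.exp 8 * lam ^ 2)))
      ≤ Real.exp (-b) := by
    rw [Real.exp_le_exp, neg_le_neg_iff, hb, mul_assoc (1 / 51)]
    gcongr
  linarith

/-- If `n (1 - p)` is bounded above, the random graph is asymptotically almost surely connected. -/
theorem tendsto_embeddedGraphLaw_real_not_connected {p : ℕ → unitInterval} {b : ℝ}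
    (hp : ∀ᶠ n : ℕ in atTop, n * (1 - (p n : ℝ)) ≤ b) :
    Tendsto (fun n : ℕ => (embeddedGraphLaw n (p n)).real {ω | ¬ ω.2.Connected}) atTop (𝓝 0) := by
  have hlim : Tendsto (fun n : ℕ => (b + b ^ 2) / (n : ℝ)) atTop (𝓝 0) :=
    tendsto_const_nhds.div_atTop tendsto_natCast_atTop_atTop
  refine squeeze_zero' (Eventually.of_forall fun _ => measureReal_nonneg) ?_ hlim
  filter_upwards [hp, eventually_ge_atTop 2] with n hn hn2
  have hn0 : (0 : ℝ) < n := by exact_mod_cast (by omega : 0 < n)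
  have hset : {ω : (Fin n → Plane) × SimpleGraph (Fin n) | ¬ ω.2.Connected}
      = Set.univ ×ˢ {G | ¬ G.Connected} := by ext ω; simp
  rw [hset, embeddedGraphLaw, measureReal_prod_prod, probReal_univ, one_mul]
  refine (binomialRandom_real_not_connected_le hn2 (p n)).trans ?_
  have hq : 0 ≤ 1 - (p n : ℝ) := by linarith [(p n).2.2]
  rw [le_div_iff₀ hn0]
  have h0 : 0 ≤ n * (1 - (p n : ℝ)) := by positivity
  nlinarith

/-- Doubling `lam` turns the complement's weak inequality into a strict one; subadditivity on a
cover needs no measurability. -/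
theorem le_real_connected_and_lt_stretchFactor (n : ℕ) (p : unitInterval) {lam : ℝ}
    (hlam : 0 < lam) :
    1 - (embeddedGraphLaw n p).real {ω | stretchFactor ω.1 ω.2 < ENNReal.ofReal (2 * lam)}
        - (embeddedGraphLaw n p).real {ω | ¬ ω.2.Connected}
      ≤ (embeddedGraphLaw n p).real
        {ω | ω.2.Connected ∧ ENNReal.ofReal lam < stretchFactor ω.1 ω.2} := by
  have hcover : (Set.univ : Set ((Fin n → Plane) × SimpleGraph (Fin n)))
      ⊆ {ω | ω.2.Connected ∧ ENNReal.ofReal lam < stretchFactor ω.1 ω.2}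
        ∪ ({ω | stretchFactor ω.1 ω.2 < ENNReal.ofReal (2 * lam)} ∪ {ω | ¬ ω.2.Connected}) := by
    intro ω _
    by_cases h1 : ω.2.Connected
    · by_cases h2 : stretchFactor ω.1 ω.2 < ENNReal.ofReal (2 * lam)
      · exact Or.inr (Or.inl h2)
      · refine Or.inl ⟨h1, lt_of_lt_of_le ?_ (not_lt.1 h2)⟩
        exact (ENNReal.ofReal_lt_ofReal_iff (by linarith)).2 (by linarith)
    · exact Or.inr (Or.inr h1)
  have h1 := (measureReal_mono hcover (measure_ne_top (embeddedGraphLaw n p) _)).trans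
    (measureReal_union_le _ _)
  rw [probReal_univ] at h1
  have h2 := measureReal_union_le (μ := embeddedGraphLaw n p)
    {ω | stretchFactor ω.1 ω.2 < ENNReal.ofReal (2 * lam)} {ω | ¬ ω.2.Connected}
  linarith

end RandomStretch

theorem lemma6 :
    (∃ ε : ℕ → ℝ, Tendsto ε atTop (𝓝 0) ∧
      ∀ (c : ℝ), 1 / 51 < c → c < 1 / (16 * Real.pi) →
      ∀ (n : ℕ) (p : unitInterval) (lam : ℝ), 0 < lam →
        (RandomStretch.embeddedGraphLaw n p).real
            {ω | RandomStretch.stretchFactor ω.1 ω.2 < ENNReal.ofReal lam}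
          ≤ Real.exp (-(c * n * (1 - (p : ℝ)) / (2 * Real.exp 8 * lam ^ 2))) + ε n) ∧
    (∀ p : ℕ → unitInterval,
      (fun n : ℕ => (n : ℝ) * (1 - (p n : ℝ))) =Θ[atTop] (fun _ : ℕ => (1 : ℝ)) →
      ∀ lam : ℝ, 0 < lam →
        (∃ δ : ℝ, 0 < δ ∧ ∀ᶠ n : ℕ in atTop,
          δ ≤ (RandomStretch.embeddedGraphLaw n (p n)).real
            {ω | ω.2.Connected ∧
              ENNReal.ofReal lam < RandomStretch.stretchFactor ω.1 ω.2}) ∧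
        ¬ Tendsto (fun n : ℕ => (RandomStretch.embeddedGraphLaw n (p n)).real
            {ω | RandomStretch.stretchFactor ω.1 ω.2 < ENNReal.ofReal lam}) atTop (𝓝 1)) := by
  refine ⟨⟨fun n => 131072 / ((n : ℝ) + 1), RandomStretch.tendsto_const_div_natCast_add_one _, ?_⟩,
    ?_⟩
  · intro c hc1 hc2 n p lam hlam
    exact RandomStretch.embeddedGraphLaw_real_stretchFactor_lt_le_exp hc2 n p hlam
  · intro p hp lam hlam
    have hq : ∀ n : ℕ, 0 ≤ (n : ℝ) * (1 - (p n : ℝ)) := fun n =>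
      mul_nonneg n.cast_nonneg (by linarith [(p n).2.2])
    -- The upper half of `Θ` serves connectivity, the lower half the tail bound.
    obtain ⟨b, hb⟩ := hp.1.bound
    obtain ⟨a, ha, hap⟩ := hp.2.exists_pos
    have hlower : ∀ᶠ n : ℕ in atTop, a⁻¹ ≤ n * (1 - (p n : ℝ)) := by
      filter_upwards [hap.bound] with n hn
      rw [norm_one, Real.norm_of_nonneg (hq n)] at hn
      rwa [inv_le_iff_one_le_mul₀ ha, mul_comm]
    have hupper : ∀ᶠ n : ℕ in atTop, n * (1 - (p n : ℝ)) ≤ b := by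
      filter_upwards [hb] with n hn
      rwa [norm_one, mul_one, Real.norm_of_nonneg (hq n)] at hn
    constructor
    · obtain ⟨δ, hδ, h⟩ := RandomStretch.exists_embeddedGraphLaw_real_stretchFactor_lt_le
        (inv_pos.2 ha) hlower (show 0 < 2 * lam by linarith)
      have hconn := (RandomStretch.tendsto_embeddedGraphLaw_real_not_connected
        hupper).eventually_lt_const (half_pos hδ)
      refine ⟨δ / 2, half_pos hδ, ?_⟩
      filter_upwards [h, hconn] with n h1 h2
      have := RandomStretch.le_real_connected_and_lt_stretchFactor n (p n) hlam
      linarith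
    · intro hlim
      obtain ⟨δ, hδ, h⟩ := RandomStretch.exists_embeddedGraphLaw_real_stretchFactor_lt_le
        (inv_pos.2 ha) hlower hlam
      have := le_of_tendsto hlim h
      linarith
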